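/- Let $G$ be a locally compact, second countable, Hausdorff topological group with left Haar measure $\lambda$, and let $\mathbf X,\mathbf Y$ be topological spaces whose Borel $\sigma$-algebras are standard Borel, on each of which $G$ acts continuously. Assume that the action on $\mathbf X$ is proper: there is a measurable $h\colon\mathbf X\to(0,\infty)$ with $\int_G h(gx)\,\lambda(dg)<\infty$ for every $x\in\mathbf X$. Let $X,Y$ be random elements of $\mathbf X,\mathbf Y$ on a common probability space, and let $P_X$ be the distribution of $X$. **Terminology.** Below, *measurable* functions of $x\in\mathbf X$ are measurable with respect to the $P_X$-completion of the Borel $\sigma$-algebra, and the properties defining them may fail for $x$ in a $P_X$-null set $\mathcal N$ (put $S=\mathbf X\setminus\mathcal N$). * A *maximal invariant* is a measurable map $M$ from $\mathbf X$ to a standard Borel space such that, for $x,x'\in S$, $M(x)=M(x')$ if and only if $x,x'$ lie on the same $G$-orbit. * An *orbit selector* is a measurable map $\gamma\colon\mathbf X\to\mathbf X$ such that $\gamma(x)\in Gx$ for $x\in S$, and $\gamma(x)=\gamma(x')$ whenever $x,x'\in S$ lie on the same orbit. * An *inversion kernel* associated with $\gamma$ is a measurable family $(\zeta(x,\cdot))_{x\in\mathbf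 X}$ of measures on $G$ such that for all $x\in S$: $\zeta(x,\cdot)$ is a probability measure; $\zeta(gx,B)=\zeta(x,g^{-1}B)$ for all $g\in G$ and Borel $B\subseteq G$; $\zeta(\gamma(x),\cdot)$ is the normalized Haar measure of the stabilizer of $\gamma(x)$; and $t\gamma(x)=x$ for $\zeta(x,\cdot)$-almost every $t$. * A *representative inversion* associated with $\gamma$ is a measurable map $\tau\colon\mathbf X\to G$ such that $\tau(x)\gamma(x)=x$ and $\tau(gx)=g\tau(x)$ for all $x\in S$, $g\in G$. * The conditional distribution $P_{Y|X}$ is *$G$-equivariant* if it has a regular version, i.e. a Borel Markov kernel $Q$ from $\mathbf X$ to $\mathbf Y$ with $P_{X,Y}=P_X\otimes Q$, such that $Q(x,B)=Q(gx,gB)$ for all $x\in\mathbf X$, $g\in G$ and Borel $B\subseteq\mathbf Y$. **Theorem.** There exist an orbit selector $\gamma$ and an inversion kernel $\zeta$ associated with it (even with $\mathcal N=\emptyset$). Moreover, for every maximal invariant $M$: 1. Let $\zeta$ be an inversion kernel associated with an orbit selector, and let $\tilde\tau$ be a random element of $G$, on the same probability space, that is drawn from $\zeta(X,\cdot)$,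 i.e. whose conditional distribution given $(X,Y)$ is $\zeta(X,\cdot)$. Then $P_{Y|X}$ is $G$-equivariant if and only if $$(\tilde\tau,X)\perp\!\!\!\perp\tilde\tau^{-1}Y\mid M(X).$$ 2. If $\tau$ is a representative inversion associated with an orbit selector, then $P_{Y|X}$ is $G$-equivariant if and only if $X\perp\!\!\!\perp\tau(X)^{-1}Y\mid M(X)$. 3. If $G$ acts trivially on $\mathbf Y$, then $P_{Y|X}$ is $G$-equivariant if and only if $X\perp\!\!\!\perp Y\mid M(X)$. -/

import Mathlib

open MeasureTheory ProbabilityTheory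
open scoped Pointwise ENNReal

/-- The action of `G` on `E` is proper: some strictly positive measurable function `h` on `E` has
`∫ h (g x) λ(dg) < ∞` for every `x`, where `λ` is a left Haar measure of `G`. -/
def IsProperAction (G E : Type*) [Group G] [TopologicalSpace G] [IsTopologicalGroup G]
    [LocallyCompactSpace G] [MeasurableSpace G] [BorelSpace G]
    [MeasurableSpace E] [MulAction G E] : Prop :=
  ∃ h : E → ℝ, Measurable h ∧ (∀ x, 0 < h x) ∧
    ∀ x, ∫⁻ g : G, ENNReal.ofReal (h (g • x)) ∂Measure.haar < ∞

/-- `M` is a maximal invariant on `S`: two points of `S` have the same value exactly when they lie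
on the same orbit. `S = Set.univ` is the plain notion; a smaller `S` of full measure allows an
exceptional null set. -/
def IsMaximalInvariantOn (G : Type*) {E F : Type*} [Group G] [MulAction G E]
    (S : Set E) (M : E → F) : Prop :=
  ∀ x ∈ S, ∀ x' ∈ S, M x = M x' ↔ x ∈ MulAction.orbit G x'

/-- `γ` is an orbit selector on `S`: it maps each point to a point of its orbit, the same one for
all points of the orbit. -/
def IsOrbitSelectorOn (G : Type*) {E : Type*} [Group G] [MulAction G E]
    (S : Set E) (γ : E → E) : Prop :=
  (∀ x ∈ S, γ x ∈ MulAction.orbit G x) ∧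
    ∀ x ∈ S, ∀ x' ∈ S, x ∈ MulAction.orbit G x' → γ x = γ x'

/-- `ν` is the normalized Haar measure of the subgroup `H`, regarded as a measure on `G`. -/
def IsNormalizedHaarOf {G : Type*} [Group G] [TopologicalSpace G] [MeasurableSpace G]
    (H : Subgroup G) (ν : Measure G) : Prop :=
  ∃ η : Measure H, η.IsHaarMeasure ∧ IsProbabilityMeasure η ∧ ν = η.map Subtype.val

/-- `ζ` is an inversion kernel on `S`, associated with the orbit selector `γ`. (The measurability
of `x ↦ ζ x` is a separate assumption.) -/
structure IsInversionKernelOn {G E : Type*} [Group G] [TopologicalSpace G] [MeasurableSpace G]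
    [MulAction G E] (S : Set E) (γ : E → E) (ζ : E → Measure G) : Prop where
  isProb : ∀ x ∈ S, IsProbabilityMeasure (ζ x)
  equivariant : ∀ x ∈ S, ∀ g : G, ∀ B : Set G, MeasurableSet B → ζ (g • x) B = ζ x (g⁻¹ • B)
  haar : ∀ x ∈ S, IsNormalizedHaarOf (MulAction.stabilizer G (γ x)) (ζ (γ x))
  inverts : ∀ x ∈ S, ∀ᵐ t ∂ζ x, t • γ x = x

/-- `τ` is a representative inversion on `S`, associated with the orbit selector `γ`. -/
def IsRepresentativeInversionOn {G E : Type*} [Group G] [MulAction G E]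
    (S : Set E) (γ : E → E) (τ : E → G) : Prop :=
  ∀ x ∈ S, τ x • γ x = x ∧ ∀ g : G, τ (g • x) = g * τ x

/-- The conditional distribution of `Y` given `X` is `G`-equivariant: it has a regular version `Q`
with `Q (x, B) = Q (g x, g B)` for all `g`, `x` and measurable `B`. -/
def CondDistribEquivariant (G : Type*) {E F Ω : Type*} [Group G]
    [MeasurableSpace E] [MeasurableSpace F] [MulAction G E] [MulAction G F]
    [MeasurableSpace Ω] (μ : Measure Ω) (X : Ω → E) (Y : Ω → F) : Prop :=
  ∃ Q : Kernel E F, IsMarkovKernel Q ∧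
    μ.map (fun ω => (X ω, Y ω)) = μ.map X ⊗ₘ Q ∧
    ∀ (g : G) (x : E) (B : Set F), MeasurableSet B → Q x B = Q (g • x) (g • B)

/-- Conditionally on `(X, Y)`, the random element `T` has distribution `ζ X`; that is, `T` given
`X` is drawn from `ζ X`, with no further dependence on `Y`. -/
def IsDrawnFrom {E F H Ω : Type*} [MeasurableSpace E] [MeasurableSpace F] [MeasurableSpace H]
    [MeasurableSpace Ω] (μ : Measure Ω) (X : Ω → E) (Y : Ω → F) (ζ : E → Measure H)
    (T : Ω → H) : Prop :=
  ∀ (A : Set (E × F)) (B : Set H), MeasurableSet A → MeasurableSet B →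
    μ {ω | (X ω, Y ω) ∈ A ∧ T ω ∈ B} = ∫⁻ ω in {ω | (X ω, Y ω) ∈ A}, ζ (X ω) B ∂μ

/-- Conditional independence `U ⊥ V | W` of random elements of standard Borel spaces, measurable up
to null sets: the regular conditional distribution of `(U, V)` given `W` is a product. -/
def CondIndepGiven {A B C Ω : Type*} [MeasurableSpace A] [MeasurableSpace B] [MeasurableSpace C]
    [MeasurableSpace Ω] (μ : Measure Ω) (U : Ω → A) (V : Ω → B) (W : Ω → C) : Prop :=
  ∃ (κ : Kernel C A) (η : Kernel C B), IsMarkovKernel κ ∧ IsMarkovKernel η ∧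
    μ.map (fun ω => (W ω, U ω, V ω)) = μ.map W ⊗ₘ (κ ×ₖ η)

/-!
Under the measure `h (g x) λ(dg)` provided by properness, normalized, `g⁻¹` has a law `ξ x` with
`ξ (k x) = k · ξ x`. If `t ∼ ξ x`, then the law of `t⁻¹ x` depends only on the orbit of `x` and is
concentrated on it, so it is a measurable invariant separating the orbits. A measurable almost
everywhere section of this invariant is an orbit selector. With `t ∼ ξ x` and `t'` drawn from `ξ s`
conditionally on `t'⁻¹ s = t⁻¹ x`, the product `t t'⁻¹` takes `s` to `x`; its law is equivariant in
`x`, and for `s = γ x` it is an inversion kernel. Translating by this kernel also turns a kernel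
that is equivariant on a set of full measure into an equivariant one.

Let `T` be drawn from `ζ X`, so that `T (γ X) = X`. If the conditional law `Q` of `Y` given `X` is
equivariant, then `Q X = T · Q (γ X)`, so that given `(T, X)` the law of `T⁻¹ Y` is `Q (γ X)`, a
function of `M X`. Conversely, if the law `η` of `T⁻¹ Y` given `(T, X)` depends only on `M X`, then
`Y = T (T⁻¹ Y)`, given `X`, is distributed as `t y` with independent `t ∼ ζ X` and `y ∼ η`, a law
that is equivariant in `X` because `η` is invariant. A representative inversion `τ` is the case
where `ζ x` is the Dirac mass at `τ x`.
-/

/-- The family of measures `κ` is equivariant: translating the parameter by `g` translates the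
measure by `g`. The case `F = G` is that of left multiplication. -/
def IsEquivariant (G : Type*) {E F : Type*} [SMul G E] [SMul G F] [MeasurableSpace F]
    (κ : E → Measure F) : Prop :=
  ∀ (g : G) (x : E), κ (g • x) = (κ x).map (g • ·)

/-- Equivariance of `κ` as long as the parameter stays in the set `S`, which need not be
invariant. -/
def IsEquivariantOn (G : Type*) {E F : Type*} [SMul G E] [SMul G F] [MeasurableSpace F]
    (S : Set E) (κ : E → Measure F) : Prop :=
  ∀ (g : G), ∀ x ∈ S, g • x ∈ S → κ (g • x) = (κ x).map (g • ·)

theorem polishSpace_of_locallyCompact_group (G : Type*) [Group G] [TopologicalSpace G]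
    [IsTopologicalGroup G] [LocallyCompactSpace G] [SecondCountableTopology G] [T2Space G] :
    PolishSpace G := by
  let _ : UniformSpace G := IsTopologicalGroup.rightUniformSpace G
  have : IsRightUniformGroup G := { toIsTopologicalGroup := inferInstance, uniformity_eq := rfl }
  have hcomplete : CompleteSpace G := IsRightUniformGroup.completeSpace_of_weaklyLocallyCompactSpace
  have : (uniformity G).IsCountablyGenerated := by
    rw [uniformity_eq_comap_nhds_one]
    infer_instance
  have : TopologicalSpace.IsCompletelyMetrizableSpace G :=
    ⟨UniformSpace.metricSpace G, rfl, hcomplete⟩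
  exact {}

section EquivariantKernel

theorem exists_isEquivariant_isMarkovKernel_of_eq_smul_map {G E F : Type*} [SMul G E] [SMul G F]
    [MeasurableSpace E] [MeasurableSpace F] [MeasurableConstSMul G F] (κ : Kernel E F)
    (hκ0 : ∀ x, κ x Set.univ ≠ 0) (hκ : ∀ x, κ x Set.univ ≠ ∞)
    (h : ∀ (g : G) x, ∃ c : ℝ≥0∞, κ (g • x) = c • (κ x).map (g • ·)) :
    ∃ ξ : Kernel E F, IsMarkovKernel ξ ∧ IsEquivariant G ξ := by
  let ξ : Kernel E F :=
    ⟨fun x => (κ x Set.univ)⁻¹ • κ x, Measure.measurable_of_measurable_coe _ fun B hB =>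
      (κ.measurable_coe .univ).inv.mul (κ.measurable_coe hB)⟩
  refine ⟨ξ, ⟨fun x => ⟨ENNReal.inv_mul_cancel (hκ0 x) (hκ x)⟩⟩, fun g x => ?_⟩
  obtain ⟨c, hc⟩ := h g x
  have hmass : κ (g • x) Set.univ = c * κ x Set.univ := by
    rw [hc, Measure.smul_apply, Measure.map_apply (measurable_const_smul g) .univ,
      Set.preimage_univ, smul_eq_mul]
  have hc0 : c ≠ 0 := fun h0 => hκ0 (g • x) (by rw [hmass, h0, zero_mul])
  have hct : c ≠ ∞ := fun ht => hκ (g • x) (by rw [hmass, ht, ENNReal.top_mul (hκ0 x)])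
  calc (κ (g • x) Set.univ)⁻¹ • κ (g • x)
      = ((c * κ x Set.univ)⁻¹ * c) • (κ x).map (g • ·) := by rw [hmass, hc, smul_smul]
    _ = (κ x Set.univ)⁻¹ • (κ x).map (g • ·) := by
        rw [ENNReal.mul_inv (.inl hc0) (.inl hct), mul_right_comm,
          ENNReal.inv_mul_cancel hc0 hct, one_mul]
    _ = ((κ x Set.univ)⁻¹ • κ x).map (g • ·) := (Measure.map_smul ..).symm

variable {G E : Type*} [Group G] [TopologicalSpace G] [IsTopologicalGroup G]
  [LocallyCompactSpace G] [SecondCountableTopology G] [MeasurableSpace G] [BorelSpace G]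

theorem IsProperAction.exists_isEquivariant_kernel [MeasurableSpace E] [MulAction G E]
    [MeasurableSMul₂ G E] (hp : IsProperAction G E) :
    ∃ ξ : Kernel E G, IsMarkovKernel ξ ∧ IsEquivariant G ξ := by
  obtain ⟨h, hm, hpos, hfin⟩ := hp
  have hdens : Measurable (Function.uncurry fun (x : E) (g : G) => ENNReal.ofReal (h (g • x))) := by
    unfold Function.uncurry
    fun_prop
  let κ : Kernel E G := ((Kernel.const E (Measure.haar : Measure G)).withDensity
    fun x g => ENNReal.ofReal (h (g • x))).map Inv.inv
  have lintegral_κ x {u : G → ℝ≥0∞} (hu : Measurable u) :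
      ∫⁻ t, u t ∂κ x = ∫⁻ g, ENNReal.ofReal (h (g • x)) * u g⁻¹ ∂Measure.haar := by
    rw [Kernel.lintegral_map _ measurable_inv _ hu,
      Kernel.lintegral_withDensity _ hdens _ (g := fun g => u g⁻¹) (hu.comp measurable_inv),
      Kernel.const_apply]
  have κ_univ x : κ x Set.univ = ∫⁻ g : G, ENNReal.ofReal (h (g • x)) ∂Measure.haar := by
    simpa using lintegral_κ x (u := 1) measurable_one
  refine exists_isEquivariant_isMarkovKernel_of_eq_smul_map κ (fun x => ?_)
    (fun x => (κ_univ x).trans_ne (hfin x).ne) fun k x => ?_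
  · rw [κ_univ, ← pos_iff_ne_zero, lintegral_pos_iff_support (hdens.of_uncurry_left (x := x))]
    have : (Function.support fun g : G => ENNReal.ofReal (h (g • x))) = Set.univ :=
      Set.eq_univ_of_forall fun g => (ENNReal.ofReal_pos.2 (hpos _)).ne'
    rw [this]
    exact Measure.measure_univ_pos.2 (NeZero.ne _)
  · refine ⟨Measure.modularCharacterFun k, Measure.ext_of_lintegral _ fun u hu => ?_⟩
    have hku : Measurable fun g => u (k • g) := hu.comp (measurable_const_smul k)
    have hv : Measurable fun g : G => ENNReal.ofReal (h (g • x)) * u (k • g⁻¹) :=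
      (hdens.of_uncurry_left (x := x)).mul (hku.comp measurable_inv)
    calc ∫⁻ t, u t ∂κ (k • x)
        = ∫⁻ g, ENNReal.ofReal (h ((g * k) • x)) * u (k • (g * k)⁻¹) ∂Measure.haar := by
          rw [lintegral_κ _ hu]
          simp [mul_smul]
      _ = ∫⁻ g, ENNReal.ofReal (h (g • x)) * u (k • g⁻¹)
            ∂(Measure.modularCharacterFun k • Measure.haar) := by
          rw [← Measure.map_right_mul_eq_modularCharacterFun_smul,
            lintegral_map hv (measurable_mul_const k)]
      _ = ∫⁻ t, u t ∂((Measure.modularCharacterFun k : ℝ≥0∞) • (κ x).map (k • ·)) := by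
          rw [lintegral_smul_measure, lintegral_smul_measure,
            lintegral_map hu (measurable_const_smul k), lintegral_κ x hku, ENNReal.smul_def]

end EquivariantKernel

section SmulKernel

variable {G E F : Type*} [Group G] [MeasurableSpace G] [MeasurableSpace E] [MeasurableSpace F]
  [MulAction G F] [MeasurableSMul₂ G F]

/-- The law of `t • y`, where `t` and `y` are independent with laws `κ x` and `η x`. -/
noncomputable def smulKernel (κ : Kernel E G) (η : Kernel E F) : Kernel E F :=
  (κ ×ₖ η).map (Function.uncurry (· • ·))

instance (κ : Kernel E G) (η : Kernel E F) [IsMarkovKernel κ] [IsMarkovKernel η] :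
    IsMarkovKernel (smulKernel κ η) :=
  Kernel.IsMarkovKernel.map _ measurable_smul

variable (κ : Kernel E G) (η : Kernel E F) [IsMarkovKernel κ] [IsMarkovKernel η] {x : E}

theorem smulKernel_apply :
    smulKernel κ η x = ((κ x).prod (η x)).map (Function.uncurry (· • ·)) := by
  rw [smulKernel, Kernel.map_apply _ measurable_smul, Kernel.prod_apply]

variable {κ η}

theorem smulKernel_apply_eq_of_ae {ν : Measure F} (h : ∀ᵐ t ∂κ x, (η x).map (t • ·) = ν) :
    smulKernel κ η x = ν := by
  refine Measure.ext_of_lintegral _ fun u hu => ?_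
  have hu' : Measurable fun p : G × F => u (Function.uncurry (· • ·) p) := hu.comp measurable_smul
  calc ∫⁻ y, u y ∂smulKernel κ η x
      = ∫⁻ t, ∫⁻ y, u y ∂(η x).map (t • ·) ∂κ x := by
        rw [smulKernel_apply, lintegral_map hu measurable_smul,
          lintegral_prod _ hu'.aemeasurable]
        simp only [Function.uncurry_apply_pair, lintegral_map hu (measurable_const_smul _)]
    _ = ∫⁻ _, ∫⁻ y, u y ∂ν ∂κ x := lintegral_congr_ae (h.mono fun t ht => by simp only [ht])
    _ = ∫⁻ y, u y ∂ν := by simp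

theorem smulKernel_smul [MeasurableConstSMul G G] [SMul G E] {g : G}
    (hκ : κ (g • x) = (κ x).map (g • ·)) (hη : η (g • x) = η x) :
    smulKernel κ η (g • x) = (smulKernel κ η x).map (g • ·) := by
  have hg := measurable_const_smul (α := G) g
  rw [smulKernel_apply, smulKernel_apply, hκ, hη, ← Measure.map_id (μ := η x),
    Measure.map_prod_map _ _ hg measurable_id, Measure.map_map measurable_smul (by fun_prop),
    Measure.map_id, Measure.map_map (measurable_const_smul g) measurable_smul]
  congr 1
  ext ⟨t, y⟩
  exact mul_smul g t y

end SmulKernel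

section OrbitInvariant

theorem exists_measurable_injOn_isProbabilityMeasure (E : Type*) [MeasurableSpace E]
    [StandardBorelSpace E] :
    ∃ c : Measure E → ℚ → ℝ≥0∞, Measurable c ∧ Set.InjOn c {ν | IsProbabilityMeasure ν} := by
  have he := measurableEmbedding_embeddingReal E
  refine ⟨fun ν q => ν (embeddingReal E ⁻¹' Set.Iic (q : ℝ)), measurable_pi_lambda _ fun q =>
    Measure.measurable_coe (he.measurable measurableSet_Iic), fun ν hν ν' hν' h => ?_⟩
  rw [Set.mem_ofPred_eq] at hν hν'
  have := Measure.isProbabilityMeasure_map (μ := ν) he.measurable.aemeasurable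
  suffices ν.map (embeddingReal E) = ν'.map (embeddingReal E) by
    rw [← he.comap_map ν, ← he.comap_map ν', this]
  refine ext_of_generate_finite _
    (BorelSpace.measurable_eq.trans Real.borel_eq_generateFrom_Iic_rat)
    Real.isPiSystem_Iic_rat (fun B hB => ?_) ?_
  · obtain ⟨q, rfl⟩ := by simpa using hB
    simpa only [Measure.map_apply he.measurable measurableSet_Iic] using congrFun h q
  · simp [Measure.map_apply he.measurable .univ]

variable {G E : Type*} [Group G] [MeasurableSpace G] [StandardBorelSpace G]
  [MeasurableSpace E] [StandardBorelSpace E] [MulAction G E] [MeasurableSMul₂ G E]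

theorem mem_orbit_of_map_smul_eq {ρ ρ' : Measure G} [IsProbabilityMeasure ρ] {x y : E}
    (h : ρ.map (· • x) = ρ'.map (· • y)) : x ∈ MulAction.orbit G y := by
  by_contra hxy
  let _ := upgradeStandardBorel E
  have analyticSet_orbit (z : E) : AnalyticSet (MulAction.orbit G z) := by
    rw [MulAction.orbit, ← Set.image_univ]
    exact MeasurableSet.univ.analyticSet_image (measurable_smul_const z)
  have hdisj : Disjoint (MulAction.orbit G x) (MulAction.orbit G y) :=
    (MulAction.orbit.eq_or_disjoint x y).resolve_left (mt MulAction.orbit_eq_iff.1 hxy)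
  obtain ⟨B, hxB, hyB, hB⟩ := (analyticSet_orbit x).measurablySeparable (analyticSet_orbit y) hdisj
  have hx : ∀ᵐ z ∂ρ.map (· • x), z ∈ B := (ae_map_iff (by fun_prop) hB).2 <|
    ae_of_all _ fun g => hxB (MulAction.mem_orbit x g)
  have hy : ∀ᵐ z ∂ρ'.map (· • y), z ∉ B := (ae_map_iff (by fun_prop) hB.compl).2 <|
    ae_of_all _ fun g => Set.disjoint_left.1 hyB (MulAction.mem_orbit y g)
  have := Measure.isProbabilityMeasure_map (μ := ρ) (measurable_smul_const x).aemeasurable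
  obtain ⟨z, hz, hz'⟩ := (hx.and (h ▸ hy)).exists
  exact hz' hz

theorem exists_measurable_eq_iff_mem_orbit [MeasurableMul G] [MeasurableInv G] {ξ : Kernel E G}
    [IsMarkovKernel ξ] (hξ : IsEquivariant G ξ) :
    ∃ M : E → ℚ → ℝ≥0∞, Measurable M ∧ ∀ x y, M x = M y ↔ x ∈ MulAction.orbit G y := by
  have := Kernel.IsMarkovKernel.map ξ measurable_inv
  let m : Kernel E E := smulKernel (ξ.map Inv.inv) Kernel.id
  have m_apply x : m x = ((ξ x).map Inv.inv).map (· • x) := by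
    rw [smulKernel_apply, Kernel.map_apply _ measurable_inv, Kernel.id_apply, Measure.prod_dirac,
      Measure.map_map measurable_smul measurable_prodMk_right]
    rfl
  have m_smul (g : G) x : m (g • x) = m x := by
    rw [m_apply, m_apply, hξ, Measure.map_map (by fun_prop) (by fun_prop),
      Measure.map_map (by fun_prop) (by fun_prop), Measure.map_map (by fun_prop) (by fun_prop)]
    congr 1
    ext t
    simp [mul_smul]
  obtain ⟨c, hc, hcinj⟩ := exists_measurable_injOn_isProbabilityMeasure E
  refine ⟨fun x => c (m x), hc.comp m.measurable, fun x y => ⟨fun h => ?_, ?_⟩⟩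
  · have hm : m x = m y := hcinj (inferInstance : IsProbabilityMeasure (m x))
      (inferInstance : IsProbabilityMeasure (m y)) h
    have := Measure.isProbabilityMeasure_map (μ := ξ x) measurable_inv.aemeasurable
    rw [m_apply, m_apply] at hm
    exact mem_orbit_of_map_smul_eq hm
  · rintro ⟨g, rfl⟩
    exact congrArg c (m_smul g y)

end OrbitInvariant

section AlmostEverywhere

/-- Draw a point of the fibre `M ⁻¹' {n}` from the conditional distribution given `M = n`, as a
measurable function of `n` and a uniform random variable `u`: almost every fixed `u` will do. -/
theorem exists_measurable_ae_section {E N : Type*} [MeasurableSpace E] [StandardBorelSpace E]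
    [Nonempty E] [MeasurableSpace N] [MeasurableEq N] {P : Measure E} [IsFiniteMeasure P]
    {M : E → N} (hM : Measurable M) {S : Set E} (hS : MeasurableSet S) (hPS : S ∈ ae P) :
    ∃ s : N → E, Measurable s ∧ ∀ᵐ x ∂P, M (s (M x)) = M x ∧ s (M x) ∈ S := by
  obtain ⟨f, hf, hfmap⟩ :=
    (condDistrib id M P).exists_measurable_map_eq_unitInterval
  have hgood : MeasurableSet {p : N × E | M p.2 = p.1 ∧ p.2 ∈ S} :=
    (measurableSet_eq_fun (hM.comp measurable_snd) measurable_fst).inter (measurable_snd hS)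
  have ae_condDistrib : ∀ᵐ n ∂P.map M, ∀ᵐ y ∂condDistrib id M P n, M y = n ∧ y ∈ S := by
    apply Measure.ae_ae_of_ae_compProd (p := fun p : N × E => M p.2 = p.1 ∧ p.2 ∈ S)
    rw [compProd_map_condDistrib aemeasurable_id, ae_map_iff (by fun_prop) hgood]
    filter_upwards [hPS] with x hx using ⟨rfl, hx⟩
  have ae_uniform : ∀ᵐ n ∂P.map M, ∀ᵐ u : unitInterval, M (f n u) = n ∧ f n u ∈ S := by
    filter_upwards [ae_condDistrib] with n hn
    rw [← hfmap n] at hn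
    exact ae_of_ae_map hf.of_uncurry_left.aemeasurable hn
  have hgood' : MeasurableSet {p : N × unitInterval | M (f p.1 p.2) = p.1 ∧ f p.1 p.2 ∈ S} :=
    (measurable_fst.prodMk hf) hgood
  obtain ⟨u, hu⟩ := ((Measure.ae_ae_comm hgood').1 ae_uniform).exists
  exact ⟨(f · u), hf.of_uncurry_right, ae_of_ae_map hM.aemeasurable hu⟩

theorem exists_measurable_eq_comp {E N Z : Type*} [MeasurableSpace E] [StandardBorelSpace E]
    [MeasurableSpace N] [MeasurableSpace.CountablySeparated N]
    [MeasurableSpace Z] [StandardBorelSpace Z] [Nonempty Z] {M : E → N} {γ : E → Z}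
    (hM : Measurable M) (hγ : Measurable γ) (h : ∀ x x', M x = M x' → γ x = γ x') :
    ∃ s : N → Z, Measurable s ∧ γ = s ∘ M := by
  suffices Measurable[MeasurableSpace.comap M inferInstance] γ from this.exists_eq_measurable_comp
  intro A hA
  have saturated : M ⁻¹' (M '' (γ ⁻¹' A)) = γ ⁻¹' A := by
    refine (Set.subset_preimage_image M _).antisymm' ?_
    rintro x ⟨x', hx', hxx'⟩
    rwa [Set.mem_preimage, ← h x' x hxx']
  have : MeasurableSpace.CountablySeparated (Set.range M) :=
    MeasurableSpace.Subtype.countablySeparated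
  obtain ⟨C, hC, hCA⟩ := hM.measurableSet_preimage_iff_preimage_val.1 (saturated ▸ hγ hA)
  refine ⟨C, hC, ?_⟩
  calc M ⁻¹' C = Set.rangeFactorization M ⁻¹' (Subtype.val ⁻¹' C) := rfl
    _ = γ ⁻¹' A := by
      rw [hCA]
      exact saturated

theorem exists_measurable_ae_eq_comp {E N Z : Type*} [MeasurableSpace E] [StandardBorelSpace E]
    [MeasurableSpace N] [MeasurableSpace.CountablySeparated N]
    [MeasurableSpace Z] [StandardBorelSpace Z] [Nonempty Z] {P : Measure E} {M : E → N} {γ : E → Z}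
    (hM : AEMeasurable M P) (hγ : AEMeasurable γ P) {S : Set E} (hPS : S ∈ ae P)
    (h : ∀ x ∈ S, ∀ x' ∈ S, M x = M x' → γ x = γ x') :
    ∃ s : N → Z, Measurable s ∧ γ =ᵐ[P] s ∘ M := by
  have hmk : ∀ᵐ x ∂P, x ∈ S ∧ M x = hM.mk M x ∧ γ x = hγ.mk γ x :=
    Filter.Eventually.and hPS (hM.ae_eq_mk.and hγ.ae_eq_mk)
  obtain ⟨S', hPS', hS', hmk⟩ := hmk.exists_measurable_mem
  have := hS'.standardBorel
  have hM' : Measurable fun x : S' => M x := by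
    rw [show (fun x : S' => M x) = fun x : S' => hM.mk M x from funext fun x => (hmk x x.2).2.1]
    exact hM.measurable_mk.comp measurable_subtype_coe
  have hγ' : Measurable fun x : S' => γ x := by
    rw [show (fun x : S' => γ x) = fun x : S' => hγ.mk γ x from funext fun x => (hmk x x.2).2.2]
    exact hγ.measurable_mk.comp measurable_subtype_coe
  obtain ⟨s, hs, hsγ⟩ := exists_measurable_eq_comp hM' hγ' fun x x' =>
    h x (hmk x x.2).1 x' (hmk x' x'.2).1
  exact ⟨s, hs, Filter.mem_of_superset hPS' fun x hx => congrFun hsγ ⟨x, hx⟩⟩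

end AlmostEverywhere

section InversionKernel

theorem exists_kernel_ae_fiber {E E' H : Type*} [MeasurableSpace E]
    [MeasurableSpace E'] [StandardBorelSpace E'] [MeasurableSpace H] [StandardBorelSpace H]
    [Nonempty H] (ξ : Kernel E H) [IsMarkovKernel ξ] {f : E × H → E'} (hf : Measurable f) :
    ∃ κ : Kernel (E × E') H, IsMarkovKernel κ ∧
      ∀ s, ∀ᵐ t ∂ξ s, ∀ᵐ t' ∂κ (s, f (s, t)), f (s, t') = f (s, t) := by
  let J : Kernel E (E' × H) := (Kernel.id ×ₖ ξ).map fun p => (f p, p.2)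
  have hJ : Measurable fun p : E × H => (f p, p.2) := hf.prodMk measurable_snd
  have J_apply s : J s = (ξ s).map fun t => (f (s, t), t) := by
    rw [Kernel.map_apply _ hJ, Kernel.prod_apply, Kernel.id_apply, Measure.dirac_prod,
      Measure.map_map hJ measurable_prodMk_left]
    rfl
  have : IsMarkovKernel J := Kernel.IsMarkovKernel.map _ hJ
  refine ⟨J.condKernel, inferInstance, fun s => ?_⟩
  have hfs : Measurable fun t => f (s, t) := hf.comp measurable_prodMk_left
  have hgraph : Measurable fun t => (f (s, t), t) := hfs.prodMk measurable_id
  have ae_J : ∀ᵐ p ∂J s, f (s, p.2) = p.1 := by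
    have hset : MeasurableSet {p : E' × H | f (s, p.2) = p.1} :=
      measurableSet_eq_fun (hfs.comp measurable_snd) measurable_fst
    rw [J_apply, ae_map_iff hgraph.aemeasurable hset]
    exact ae_of_all _ fun _ => rfl
  rw [← J.disintegrate J.condKernel] at ae_J
  have ae_fst := Kernel.ae_ae_of_ae_compProd ae_J
  rw [Kernel.fst_apply, J_apply, Measure.map_map measurable_fst hgraph] at ae_fst
  exact ae_of_ae_map hfs.aemeasurable ae_fst

variable {G E : Type*} [Group G] [MeasurableSpace G] [StandardBorelSpace G]
  [MeasurableMul₂ G] [MeasurableInv G]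
  [MeasurableSpace E] [StandardBorelSpace E] [MulAction G E] [MeasurableSMul₂ G E]

/-- With `t ∼ ξ x` and `t'` drawn from `ξ s` conditionally on `t'⁻¹ • s = t⁻¹ • x`, the group
element `t * t'⁻¹` takes `s` to `x`. -/
theorem exists_orbit_inversion_kernel {ξ : Kernel E G} [IsMarkovKernel ξ]
    (hξ : IsEquivariant G ξ) :
    ∃ Z : Kernel (E × E) G, IsMarkovKernel Z ∧ (∀ s, IsEquivariant G fun x => Z (s, x)) ∧
      ∀ s x, x ∈ MulAction.orbit G s → ∀ᵐ t ∂Z (s, x), t • s = x := by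
  obtain ⟨κ, _, hκ⟩ := exists_kernel_ae_fiber ξ
    (f := fun p : E × G => p.2⁻¹ • p.1) (by fun_prop)
  have hy : Measurable fun p : (E × E) × G => (p.1.1, p.2⁻¹ • p.1.2) := by fun_prop
  have hdiv : Measurable fun p : G × G => p.1 * p.2⁻¹ := by fun_prop
  let Z : Kernel (E × E) G :=
    (ξ.comap Prod.snd measurable_snd ⊗ₖ κ.comap _ hy).map fun p => p.1 * p.2⁻¹
  have lintegral_Z s x {u : G → ℝ≥0∞} (hu : Measurable u) :
      ∫⁻ t, u t ∂Z (s, x) = ∫⁻ t, ∫⁻ t', u (t * t'⁻¹) ∂κ (s, t⁻¹ • x) ∂ξ x := by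
    rw [Kernel.lintegral_map _ hdiv _ hu]
    exact Kernel.lintegral_compProd _ _ _ (hu.comp hdiv)
  refine ⟨Z, Kernel.IsMarkovKernel.map _ hdiv, fun s k x => ?_, ?_⟩
  · refine Measure.ext_of_lintegral _ fun u hu => ?_
    have hinner : Measurable fun t => ∫⁻ t', u (t * t'⁻¹) ∂κ (s, t⁻¹ • k • x) :=
      Measurable.lintegral_kernel_prod_right' (f := fun p : G × G => u (p.1 * p.2⁻¹))
        (κ := κ.comap (fun t : G => (s, t⁻¹ • k • x)) (by fun_prop)) (by fun_prop)
    have hku : Measurable fun t => u (k • t) := hu.comp (measurable_const_smul k)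
    rw [lintegral_map hu (measurable_const_smul k), lintegral_Z _ _ hu, lintegral_Z s x hku, hξ,
      lintegral_map hinner (measurable_const_smul k)]
    simp [← mul_smul, mul_assoc]
  · rintro s _ ⟨k, rfl⟩
    have hset : MeasurableSet {t : G | t • s = k • s} :=
      measurable_smul_const s (measurableSet_singleton (k • s))
    simp only [Z]
    rw [Kernel.map_apply _ hdiv, ae_map_iff hdiv.aemeasurable hset]
    refine Kernel.ae_compProd_of_ae_ae (hdiv hset) ?_
    simp only [Kernel.comap_apply, hξ k s]
    rw [(measurableEmbedding_const_smul k).ae_map_iff]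
    filter_upwards [hκ s] with t ht
    simp only [smul_eq_mul, mul_inv_rev, mul_smul, inv_smul_smul]
    filter_upwards [ht] with t' ht'
    rw [ht', smul_inv_smul]

end InversionKernel

section Regularization

variable {G E F : Type*} [Group G] [MulAction G E] [MulAction G F] [MeasurableSpace F]

theorem isEquivariant_iff_forall_apply_smul [MeasurableSpace G] [MeasurableSMul G F]
    {κ : E → Measure F} :
    IsEquivariant G κ ↔
      ∀ (g : G) (x : E) (B : Set F), MeasurableSet B → κ x B = κ (g • x) (g • B) := by
  refine forall₂_congr fun g x => ⟨fun h B hB => ?_, fun h => Measure.ext fun B hB => ?_⟩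
  · rw [h, Measure.map_apply (measurable_const_smul g) (hB.const_smul g), Set.preimage_smul,
      inv_smul_smul]
  · rw [Measure.map_apply (measurable_const_smul g) hB, Set.preimage_smul,
      h _ (hB.const_smul g⁻¹), smul_inv_smul]

variable [MeasurableSpace G] [StandardBorelSpace G] [MeasurableMul₂ G] [MeasurableInv G]
  [MeasurableSpace E] [StandardBorelSpace E] [MeasurableSMul₂ G E] [MeasurableSMul₂ G F]

theorem IsEquivariantOn.exists_isEquivariant_ae_eq {ξ : Kernel E G} [IsMarkovKernel ξ]
    (hξ : IsEquivariant G ξ) {P : Measure E} [IsFiniteMeasure P] {q : Kernel E F}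
    [IsMarkovKernel q] {S : Set E} (hq : IsEquivariantOn G S q) (hPS : S ∈ ae P) :
    ∃ Q : Kernel E F, IsMarkovKernel Q ∧ IsEquivariant G Q ∧ q =ᵐ[P] Q := by
  cases isEmpty_or_nonempty E
  · exact ⟨q, inferInstance, fun _ x => isEmptyElim x, .rfl⟩
  obtain ⟨S', hPS', hS', hS'S⟩ := Filter.Eventually.exists_measurable_mem hPS
  obtain ⟨M, hM, hM_orbit⟩ := exists_measurable_eq_iff_mem_orbit hξ
  obtain ⟨Z, _, hZ, hZ_inverts⟩ := exists_orbit_inversion_kernel hξ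
  obtain ⟨s, hs, hsM⟩ := exists_measurable_ae_section hM hS' hPS'
  have hγ : Measurable fun x => s (M x) := hs.comp hM
  refine ⟨smulKernel (Z.comap (fun x => (s (M x), x)) (hγ.prodMk measurable_id)) (q.comap _ hγ),
    inferInstance, fun g x => ?_, ?_⟩
  · have M_smul : M (g • x) = M x := (hM_orbit _ _).2 (MulAction.mem_orbit x g)
    refine smulKernel_smul ?_ ?_
    · simpa only [Kernel.comap_apply, M_smul] using hZ (s (M x)) g x
    · simp only [Kernel.comap_apply, M_smul]
  · filter_upwards [hsM, hPS'] with x ⟨hsx, hsS⟩ hxS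
    refine (smulKernel_apply_eq_of_ae ?_).symm
    filter_upwards [hZ_inverts _ x ((hM_orbit _ _).1 hsx.symm)] with t ht
    rw [← ht] at hxS
    simpa only [Kernel.comap_apply, ht] using (hq t _ (hS'S _ hsS) (hS'S _ hxS)).symm

end Regularization

section Existence

theorem isOpenPosMeasure_of_isMulLeftInvariant {H : Type*} [Group H] [TopologicalSpace H]
    [IsTopologicalGroup H] [SecondCountableTopology H] [MeasurableSpace H] [BorelSpace H]
    (η : Measure H) [η.IsMulLeftInvariant] [NeZero η] : η.IsOpenPosMeasure := by
  refine ⟨fun U hU ⟨u, hu⟩ h0 => NeZero.ne (η Set.univ) ?_⟩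
  obtain ⟨T, hT, hTU⟩ := TopologicalSpace.isOpen_iUnion_countable
    (fun k : H => (k * ·) ⁻¹' U) fun k => hU.preimage (continuous_const_mul k)
  have cover : ⋃ k : H, (k * ·) ⁻¹' U = Set.univ :=
    Set.eq_univ_of_forall fun t => Set.mem_iUnion.2 ⟨u * t⁻¹, by simpa using hu⟩
  rw [← cover, ← hTU, measure_biUnion_null_iff hT]
  exact fun k _ => (measure_preimage_mul η k U).trans h0

theorem isMulLeftInvariant_comap_subtype {G : Type*} [Group G] [MeasurableSpace G]
    [MeasurableMul G] {H : Subgroup G} (hH : MeasurableSet (H : Set G)) {ν : Measure G}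
    (hν : ∀ k ∈ H, ν.map (k * ·) = ν) :
    (ν.comap (Subtype.val : H → G)).IsMulLeftInvariant := by
  have hval : MeasurableEmbedding (Subtype.val : H → G) := .subtype_coe hH
  refine ⟨fun k => Measure.ext fun B hB => ?_⟩
  have hk : Measurable fun t : H => k * t :=
    ((measurable_const_mul k.1).comp measurable_subtype_coe).subtype_mk
  have preimage_mul : Subtype.val '' ((k * ·) ⁻¹' B) = (k.1 * ·) ⁻¹' (Subtype.val '' B) := by
    ext t
    simp only [Set.mem_image, Set.mem_preimage, Subtype.exists, exists_and_right, exists_eq_right]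
    exact exists_prop_congr (fun _ => .rfl) (H.mul_mem_cancel_left k.2).symm
  calc (ν.comap Subtype.val).map (k * ·) B
      = ν ((k.1 * ·) ⁻¹' (Subtype.val '' B)) := by
        rw [Measure.map_apply hk hB, hval.comap_apply, preimage_mul]
    _ = ν.comap Subtype.val B := by
        rw [← Measure.map_apply (measurable_const_mul _) (hval.measurableSet_image' hB),
          hν k k.2, hval.comap_apply]

theorem isNormalizedHaarOf_of_map_mul_eq {G : Type*} [Group G] [TopologicalSpace G]
    [IsTopologicalGroup G] [SecondCountableTopology G] [MeasurableSpace G] [BorelSpace G]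
    {H : Subgroup G} (hH : MeasurableSet (H : Set G)) {ν : Measure G} [IsProbabilityMeasure ν]
    (hνH : ∀ᵐ t ∂ν, t ∈ H) (hν : ∀ k ∈ H, ν.map (k * ·) = ν) : IsNormalizedHaarOf H ν := by
  have hval : MeasurableEmbedding (Subtype.val : H → G) := .subtype_coe hH
  have hmap : (ν.comap (Subtype.val : H → G)).map Subtype.val = ν := by
    rw [hval.map_comap, Measure.restrict_eq_self_of_ae_mem]
    simpa using hνH
  have hprob : IsProbabilityMeasure (ν.comap (Subtype.val : H → G)) :=
    hval.isProbabilityMeasure_comap (hνH.mono fun t ht => ⟨⟨t, ht⟩, rfl⟩)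
  have := isMulLeftInvariant_comap_subtype hH hν
  have : SecondCountableTopology H := TopologicalSpace.Subtype.secondCountableTopology _
  have := isOpenPosMeasure_of_isMulLeftInvariant (ν.comap (Subtype.val : H → G))
  exact ⟨ν.comap Subtype.val, {}, hprob, hmap.symm⟩

variable {G E : Type*} [Group G] [MeasurableSpace G] [MeasurableSpace E] [StandardBorelSpace E]
  [MulAction G E] [MeasurableSMul₂ G E] {ξ : Kernel E G} [IsMarkovKernel ξ] {P : Measure E}

theorem exists_aemeasurable_isOrbitSelectorOn_univ [StandardBorelSpace G] [MeasurableMul₂ G]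
    [MeasurableInv G] (hξ : IsEquivariant G ξ) [IsFiniteMeasure P] :
    ∃ γ : E → E, AEMeasurable γ P ∧ IsOrbitSelectorOn G Set.univ γ := by
  classical
  cases isEmpty_or_nonempty E
  · exact ⟨id, aemeasurable_id, by simp [IsOrbitSelectorOn]⟩
  obtain ⟨M, hM, hM_orbit⟩ := exists_measurable_eq_iff_mem_orbit hξ
  obtain ⟨s, hs, hsM⟩ := exists_measurable_ae_section hM .univ (Filter.univ_mem (f := ae P))
  let r n := if M (s n) = n then s n else Function.invFun M n
  have M_r x : M (r (M x)) = M x := by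
    by_cases hx : M (s (M x)) = M x
    · simp only [r, if_pos hx, hx]
    · simp only [r, if_neg hx, Function.invFun_eq ⟨x, rfl⟩]
  refine ⟨r ∘ M, ⟨s ∘ M, hs.comp hM, ?_⟩, fun x _ => (hM_orbit _ _).1 (M_r x),
    fun x _ x' _ h => congrArg r ((hM_orbit _ _).2 h)⟩
  filter_upwards [hsM] with x hx using if_pos hx.1

theorem exists_isInversionKernelOn_univ [TopologicalSpace G] [IsTopologicalGroup G]
    [PolishSpace G] [BorelSpace G] (hξ : IsEquivariant G ξ) {γ : E → E}
    (hγ : AEMeasurable γ P) (hsel : IsOrbitSelectorOn G Set.univ γ) :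
    ∃ ζ : E → Measure G, AEMeasurable ζ P ∧ IsInversionKernelOn Set.univ γ ζ := by
  obtain ⟨Z, _, hZ, hZ_inverts⟩ := exists_orbit_inversion_kernel hξ
  have γ_mem x : γ x ∈ MulAction.orbit G x := hsel.1 x trivial
  have γ_eq {x x'} (h : x ∈ MulAction.orbit G x') : γ x = γ x' := hsel.2 x trivial x' trivial h
  refine ⟨fun x => Z (γ x, x), Z.measurable.comp_aemeasurable (hγ.prodMk aemeasurable_id),
    fun _ _ => inferInstance, fun x _ g B hB => ?_, fun x _ => ?_,
    fun x _ => hZ_inverts _ _ (MulAction.mem_orbit_symm.1 (γ_mem x))⟩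
  · have hZx : Z (γ x, g • x) = (Z (γ x, x)).map (g • ·) := hZ (γ x) g x
    rw [γ_eq (MulAction.mem_orbit x g), hZx, Measure.map_apply (measurable_const_smul g) hB,
      Set.preimage_smul]
  · rw [γ_eq (γ_mem x)]
    refine isNormalizedHaarOf_of_map_mul_eq
      (measurable_smul_const (γ x) (measurableSet_singleton (γ x)))
      (hZ_inverts _ _ (MulAction.mem_orbit_self _)) fun k hk => ?_
    exact (hZ (γ x) k (γ x)).symm.trans (by rw [MulAction.mem_stabilizer_iff.1 hk])

end Existence

section ConditionalDistribution

variable {A B C D Ω : Type*} [MeasurableSpace A] [MeasurableSpace B] [MeasurableSpace C]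
  [MeasurableSpace D] [MeasurableSpace Ω] {μ : Measure Ω} {U : Ω → A} {V : Ω → B} {W : Ω → C}

theorem prod_eq_compProd_prodMkRight (κ : Kernel C A) [IsSFiniteKernel κ] (η : Kernel C B)
    [IsSFiniteKernel η] : κ ×ₖ η = κ ⊗ₖ η.prodMkRight A := by
  ext c s hs
  rw [Kernel.prod_apply, Measure.prod_apply hs, Kernel.compProd_apply hs]
  rfl

theorem hasCondDistrib_congr {κ η : Kernel A B} [IsSFiniteKernel κ] [IsSFiniteKernel η]
    (h : HasCondDistrib V U κ μ) (hκη : κ =ᵐ[μ.map U] η) : HasCondDistrib V U η μ :=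
  ⟨h.aemeasurable, h.map_eq.trans (Measure.compProd_congr hκη)⟩

theorem hasCondDistrib_compProd {κ : Kernel A B} {η : Kernel (A × B) C}
    (hV : HasCondDistrib V U κ μ) (hW : HasCondDistrib W (fun ω => (U ω, V ω)) η μ) :
    HasCondDistrib (fun ω => (V ω, W ω)) U (κ ⊗ₖ η) μ := by
  have hVm := hV.aemeasurable_snd
  have hUm := hV.aemeasurable_fst
  have hWm := hW.aemeasurable_snd
  refine ⟨by fun_prop, ?_⟩
  calc μ.map (fun ω => (U ω, V ω, W ω))
      = (μ.map fun ω => ((U ω, V ω), W ω)).map MeasurableEquiv.prodAssoc := by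
        rw [AEMeasurable.map_map_of_aemeasurable (by fun_prop) (by fun_prop)]
        rfl
    _ = μ.map U ⊗ₘ (κ ⊗ₖ η) := by
        rw [hW.map_eq, hV.map_eq, Measure.compProd_assoc']

theorem hasCondDistrib_comp_iff_of_leftInverse [SFinite μ] {κ : Kernel C B} [IsSFiniteKernel κ]
    {g : A → C} {p : C → A} (hg : Measurable g) (hp : Measurable p)
    (hpg : Function.LeftInverse p g) (hU : AEMeasurable U μ) :
    HasCondDistrib V (g ∘ U) κ μ ↔ HasCondDistrib V U (κ.comap g hg) μ := by
  refine ⟨fun h => ⟨hU.prodMk h.aemeasurable_snd, Measure.ext_of_lintegral _ fun u hu => ?_⟩,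
    fun h => h.comp_right⟩
  have hup : Measurable fun q : C × B => u (p q.1, q.2) := by fun_prop
  calc ∫⁻ q, u q ∂μ.map (fun ω => (U ω, V ω))
      = ∫⁻ q, u (p q.1, q.2) ∂μ.map (fun ω => ((g ∘ U) ω, V ω)) := by
        rw [lintegral_map' hu.aemeasurable (hU.prodMk h.aemeasurable_snd),
          lintegral_map' hup.aemeasurable h.aemeasurable]
        simp only [Function.comp_apply, hpg _]
    _ = ∫⁻ a, ∫⁻ b, u (p (g a), b) ∂κ (g a) ∂μ.map U := by
        rw [h.map_eq, Measure.lintegral_compProd hup,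
          ← AEMeasurable.map_map_of_aemeasurable hg.aemeasurable hU,
          lintegral_map hup.lintegral_kernel_prod_right' hg]
    _ = ∫⁻ q, u q ∂(μ.map U ⊗ₘ κ.comap g hg) := by
        simp only [Measure.lintegral_compProd hu, hpg _, Kernel.comap_apply]

theorem condIndepGiven_congr {U' : Ω → A} {V' : Ω → B} {W' : Ω → C} (hU : U =ᵐ[μ] U')
    (hV : V =ᵐ[μ] V') (hW : W =ᵐ[μ] W') : CondIndepGiven μ U V W ↔ CondIndepGiven μ U' V' W' := by
  have hWUV : (fun ω => (W ω, U ω, V ω)) =ᵐ[μ] fun ω => (W' ω, U' ω, V' ω) :=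
    hW.prodMk (hU.prodMk hV)
  simp only [CondIndepGiven, Measure.map_congr hW, Measure.map_congr hWUV]

theorem CondIndepGiven.comp_left [SFinite μ] (h : CondIndepGiven μ U V W) (hU : AEMeasurable U μ)
    (hV : AEMeasurable V μ) (hW : AEMeasurable W μ) {f : A → D} (hf : Measurable f) :
    CondIndepGiven μ (f ∘ U) V W := by
  obtain ⟨κ, η, hκ, hη, h⟩ := h
  have hlaw : HasCondDistrib (fun ω => (U ω, V ω)) W (κ ×ₖ η) μ := ⟨by fun_prop, h⟩
  refine ⟨κ.map f, η, Kernel.IsMarkovKernel.map _ hf, hη, ?_⟩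
  rw [← η.map_id, Kernel.map_prod_map κ η hf measurable_id]
  exact (hlaw.comp_left (f := Prod.map f id) (by fun_prop)).map_eq

theorem condIndepGiven_comp_left_iff_of_leftInverse [SFinite μ] (hU : AEMeasurable U μ)
    (hV : AEMeasurable V μ) (hW : AEMeasurable W μ) {f : A → D} {g : D → A} (hf : Measurable f)
    (hg : Measurable g) (hgf : Function.LeftInverse g f) :
    CondIndepGiven μ (f ∘ U) V W ↔ CondIndepGiven μ U V W := by
  refine ⟨fun h => ?_, fun h => h.comp_left hU hV hW hf⟩
  simpa only [← Function.comp_assoc, hgf.comp_eq_id, Function.id_comp] using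
    h.comp_left (hf.comp_aemeasurable hU) hV hW hg

theorem condIndepGiven_iff_exists_hasCondDistrib [StandardBorelSpace A] [IsProbabilityMeasure μ]
    (hU : AEMeasurable U μ) (hV : AEMeasurable V μ) (hW : AEMeasurable W μ) :
    CondIndepGiven μ U V W ↔ ∃ η : Kernel C B, IsMarkovKernel η ∧
      HasCondDistrib V (fun ω => (W ω, U ω)) (η.prodMkRight A) μ := by
  constructor
  · rintro ⟨κ, η, _, hη, h⟩
    have hlaw : HasCondDistrib (fun ω => (U ω, V ω)) W (κ ×ₖ η) μ := ⟨by fun_prop, h⟩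
    rw [prod_eq_compProd_prodMkRight] at hlaw
    exact ⟨η, hη, hlaw.of_compProd⟩
  · rintro ⟨η, hη, hlaw⟩
    have : Nonempty A := μ.nonempty_of_neZero.map U
    have hUW : HasCondDistrib U W (condDistrib U W μ) μ :=
      ⟨by fun_prop, (compProd_map_condDistrib hU).symm⟩
    refine ⟨condDistrib U W μ, η, inferInstance, hη, ?_⟩
    rw [prod_eq_compProd_prodMkRight]
    exact (hasCondDistrib_compProd hUW hlaw).map_eq

theorem condIndepGiven_iff_exists_hasCondDistrib_comap [StandardBorelSpace A]
    [IsProbabilityMeasure μ] (hU : AEMeasurable U μ) (hV : AEMeasurable V μ) {f : A → C}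
    (hf : Measurable f) (hW : W =ᵐ[μ] f ∘ U) :
    CondIndepGiven μ U V W ↔ ∃ η : Kernel C B, IsMarkovKernel η ∧
      HasCondDistrib V U (η.comap f hf) μ := by
  rw [condIndepGiven_congr .rfl .rfl hW,
    condIndepGiven_iff_exists_hasCondDistrib hU hV (hf.comp_aemeasurable hU)]
  refine exists_congr fun η => and_congr_right fun hη => ?_
  exact hasCondDistrib_comp_iff_of_leftInverse (hf.prodMk measurable_id) measurable_snd
    (fun _ => rfl) hU

theorem exists_isMarkovKernel_ae_eq {P : Measure A} [NeZero P] {ζ : A → Measure B}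
    (hζ : AEMeasurable ζ P) (hprob : ∀ᵐ x ∂P, IsProbabilityMeasure (ζ x)) :
    ∃ κ : Kernel A B, IsMarkovKernel κ ∧ ζ =ᵐ[P] κ := by
  classical
  obtain ⟨x₀, hx₀⟩ := hprob.exists
  obtain ⟨S, hPS, hS, hSζ⟩ := (hprob.and hζ.ae_eq_mk).exists_measurable_mem
  let κ : Kernel A B :=
    ⟨S.piecewise (hζ.mk ζ) fun _ => ζ x₀, hζ.measurable_mk.piecewise hS measurable_const⟩
  have κ_apply {x} (hx : x ∈ S) : κ x = ζ x :=
    (S.piecewise_eq_of_mem (hζ.mk ζ) (fun _ => ζ x₀) hx).trans (hSζ x hx).2.symm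
  have κ_apply_of_notMem {x} (hx : x ∉ S) : κ x = ζ x₀ :=
    S.piecewise_eq_of_notMem (hζ.mk ζ) (fun _ => ζ x₀) hx
  refine ⟨κ, ⟨fun x => ?_⟩, Filter.mem_of_superset hPS fun x hx => (κ_apply hx).symm⟩
  by_cases hx : x ∈ S
  · exact κ_apply hx ▸ (hSζ x hx).1
  · exact κ_apply_of_notMem hx ▸ hx₀

theorem IsDrawnFrom.hasCondDistrib [IsFiniteMeasure μ] {T : Ω → C} {ζ : A → Measure C}
    (h : IsDrawnFrom μ U V ζ T) (hU : Measurable U) (hV : Measurable V) (hT : Measurable T)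
    {κ : Kernel A C} [IsMarkovKernel κ] (hκ : ζ =ᵐ[μ.map U] κ) :
    HasCondDistrib T (fun ω => (U ω, V ω)) (κ.prodMkRight B) μ := by
  have hUV : Measurable fun ω => (U ω, V ω) := hU.prodMk hV
  refine ⟨(hUV.prodMk hT).aemeasurable, Measure.ext_prod fun {A B} hA hB => ?_⟩
  rw [Measure.map_apply (hUV.prodMk hT) (hA.prod hB), Measure.compProd_apply_prod hA hB,
    setLIntegral_map hA (Kernel.measurable_coe _ hB) hUV]
  refine (h A B hA hB).trans (lintegral_congr_ae (ae_restrict_of_ae ?_))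
  filter_upwards [ae_of_ae_map hU.aemeasurable hκ] with ω hω
  rw [hω, Kernel.prodMkRight_apply]

theorem isDrawnFrom_dirac {τ : A → C} {T : Ω → C} (hT : Measurable T)
    (h : τ ∘ U =ᵐ[μ] T) : IsDrawnFrom μ U V (fun x => Measure.dirac (τ x)) T := by
  intro A B _ hB
  calc μ {ω | (U ω, V ω) ∈ A ∧ T ω ∈ B}
      = ∫⁻ ω in {ω | (U ω, V ω) ∈ A}, (T ⁻¹' B).indicator 1 ω ∂μ := by
        rw [lintegral_indicator_one (hT hB), Measure.restrict_apply (hT hB), Set.inter_comm]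
        rfl
    _ = ∫⁻ ω in {ω | (U ω, V ω) ∈ A}, Measure.dirac (τ (U ω)) B ∂μ := by
        refine lintegral_congr_ae (ae_restrict_of_ae ?_)
        filter_upwards [h] with ω hω
        rw [Measure.dirac_apply' _ hB, ← Function.comp_apply (f := τ), hω]
        rfl

end ConditionalDistribution

section RandomTranslation

variable {G E F Ω : Type*} [Group G] [MeasurableSpace G] [MeasurableSpace F] [MulAction G F]
  [MeasurableSMul₂ G F]

theorem map_inv_smul_prod [MeasurableInv G] {ν q : Measure F} [SFinite ν] [SFinite q]
    {κ : Measure G} [SFinite κ] (h : ∀ᵐ t ∂κ, q = ν.map (t • ·)) :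
    (q.prod κ).map (fun p => (p.2, p.2⁻¹ • p.1)) = κ.prod ν := by
  have hf : Measurable fun p : F × G => (p.2, p.2⁻¹ • p.1) := by fun_prop
  refine Measure.ext_of_lintegral _ fun u hu => ?_
  calc ∫⁻ p, u p ∂(q.prod κ).map (fun p => (p.2, p.2⁻¹ • p.1))
      = ∫⁻ t, ∫⁻ y, u (t, t⁻¹ • y) ∂q ∂κ := by
        rw [lintegral_map hu hf, lintegral_prod_symm]
        fun_prop
    _ = ∫⁻ t, ∫⁻ y, u (t, y) ∂ν ∂κ := by
        refine lintegral_congr_ae ?_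
        filter_upwards [h] with t ht
        rw [ht, lintegral_map (by fun_prop) (measurable_const_smul t)]
        simp only [inv_smul_smul]
    _ = ∫⁻ p, u p ∂κ.prod ν := (lintegral_prod _ hu.aemeasurable).symm

variable [MeasurableSpace E] [MeasurableSpace Ω] {μ : Measure Ω} {X : Ω → E} {Y : Ω → F} {T : Ω → G}

theorem hasCondDistrib_inv_smul [MeasurableInv G] [SFinite μ] {κ : Kernel E G}
    [IsMarkovKernel κ] {Q η : Kernel E F} [IsMarkovKernel Q] [IsMarkovKernel η]
    (hY : HasCondDistrib Y X Q μ)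
    (hT : HasCondDistrib T (fun ω => (X ω, Y ω)) (κ.prodMkRight F) μ)
    (hQη : ∀ᵐ x ∂μ.map X, ∀ᵐ t ∂κ x, Q x = (η x).map (t • ·)) :
    HasCondDistrib (fun ω => (T ω)⁻¹ • Y ω) (fun ω => (X ω, T ω)) (η.prodMkRight G) μ := by
  have hf : Measurable fun p : F × G => (p.2, p.2⁻¹ • p.1) := by fun_prop
  have hYT := hasCondDistrib_compProd hY hT
  rw [← prod_eq_compProd_prodMkRight] at hYT
  have hTV : HasCondDistrib (fun ω => (T ω, (T ω)⁻¹ • Y ω)) X (κ ×ₖ η) μ := by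
    refine hasCondDistrib_congr (hYT.comp_left hf) ?_
    filter_upwards [hQη] with x hx
    rw [Kernel.map_apply _ hf, Kernel.prod_apply, Kernel.prod_apply, map_inv_smul_prod hx]
  rw [prod_eq_compProd_prodMkRight] at hTV
  exact hTV.of_compProd

theorem hasCondDistrib_smulKernel [SFinite μ] {κ : Kernel E G} [IsMarkovKernel κ] {η : Kernel E F}
    [IsMarkovKernel η] (hT : HasCondDistrib T X κ μ)
    (hV : HasCondDistrib (fun ω => (T ω)⁻¹ • Y ω) (fun ω => (X ω, T ω)) (η.prodMkRight G) μ) :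
    HasCondDistrib Y X (smulKernel κ η) μ := by
  have hTV := hasCondDistrib_compProd hT hV
  rw [← prod_eq_compProd_prodMkRight] at hTV
  simpa only [Function.comp_def, Function.uncurry_apply_pair, smul_inv_smul, smulKernel] using
    hTV.comp_left measurable_smul

end RandomTranslation

section Characterization

variable {G E F N Ω : Type*} [Group G] [MulAction G E]

theorem IsOrbitSelectorOn.mono {S S' : Set E} {γ : E → E} (h : IsOrbitSelectorOn G S γ)
    (hS : S' ⊆ S) : IsOrbitSelectorOn G S' γ :=
  ⟨fun x hx => h.1 x (hS hx), fun x hx x' hx' => h.2 x (hS hx) x' (hS hx')⟩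

theorem IsEquivariantOn.mono [MeasurableSpace F] [SMul G F] {S S' : Set E} {κ : E → Measure F}
    (h : IsEquivariantOn G S κ) (hS : S' ⊆ S) : IsEquivariantOn G S' κ :=
  fun g x hx hgx => h g x (hS hx) (hS hgx)

theorem IsEquivariantOn.congr [MeasurableSpace F] [SMul G F] {S : Set E} {κ η : E → Measure F}
    (h : IsEquivariantOn G S κ) (hκη : S.EqOn κ η) : IsEquivariantOn G S η :=
  fun g x hx hgx => by rw [← hκη hx, ← hκη hgx, h g x hx hgx]

theorem IsMaximalInvariantOn.mono {S S' : Set E} {M : E → N} (h : IsMaximalInvariantOn G S M)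
    (hS : S' ⊆ S) : IsMaximalInvariantOn G S' M :=
  fun x hx x' hx' => h x (hS hx) x' (hS hx')

variable [MeasurableSpace E] [MeasurableSpace N]

theorem IsMaximalInvariantOn.mk {S : Set E} {M : E → N} {P : Measure E}
    (h : IsMaximalInvariantOn G S M) (hM : AEMeasurable M P) :
    IsMaximalInvariantOn G (S ∩ {x | M x = hM.mk M x}) (hM.mk M) := by
  rintro x ⟨hx, hxM⟩ x' ⟨hx', hxM'⟩
  rw [← hxM, ← hxM']
  exact h x hx x' hx'

variable [MeasurableSpace F] [MulAction G F] [MeasurableSpace Ω] {μ : Measure Ω} {X : Ω → E}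
  {Y : Ω → F}

theorem condDistribEquivariant_iff_exists_hasCondDistrib [MeasurableSpace G] [MeasurableSMul G F]
    (hX : AEMeasurable X μ) (hY : AEMeasurable Y μ) :
    CondDistribEquivariant G μ X Y ↔
      ∃ Q : Kernel E F, IsMarkovKernel Q ∧ HasCondDistrib Y X Q μ ∧ IsEquivariant G Q := by
  have hXY : AEMeasurable (fun ω => (X ω, Y ω)) μ := hX.prodMk hY
  refine exists_congr fun Q => and_congr_right fun _ => ?_
  rw [isEquivariant_iff_forall_apply_smul]
  exact and_congr_left fun _ => ⟨fun h => ⟨hXY, h⟩, fun h => h.map_eq⟩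

variable [StandardBorelSpace E]

theorem IsEquivariant.exists_ae_eq_map_smul [MeasurableSpace.CountablySeparated N] [Nonempty E]
    {Q : Kernel E F} [IsMarkovKernel Q] (hQ : IsEquivariant G Q) {P : Measure E}
    [IsFiniteMeasure P] {S : Set E} (hPS : S ∈ ae P) {M : E → N} (hM : AEMeasurable M P)
    (hMS : IsMaximalInvariantOn G S M) {γ : E → E} (hγ : AEMeasurable γ P)
    (hγS : IsOrbitSelectorOn G S γ) :
    ∃ η : Kernel N F, IsMarkovKernel η ∧
      ∀ᵐ x ∂P, ∀ t : G, t • γ x = x → Q x = (η (M x)).map (t • ·) := by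
  obtain ⟨s, hs, hγs⟩ := exists_measurable_ae_eq_comp hM hγ hPS fun x hx x' hx' h =>
    hγS.2 x hx x' hx' ((hMS x hx x' hx').1 h)
  refine ⟨Q.comap s hs, inferInstance, ?_⟩
  filter_upwards [hγs] with x hx t ht
  have hx : γ x = s (M x) := hx
  rw [Kernel.comap_apply, ← hx, ← hQ, ht]

variable [MeasurableSpace G] [StandardBorelSpace G] [MeasurableMul₂ G] [MeasurableInv G]
  [MeasurableSMul₂ G E] [MeasurableSMul₂ G F] {T : Ω → G}
  {ξ : Kernel E G} [IsMarkovKernel ξ]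

theorem condDistribEquivariant_of_isEquivariantOn (hξ : IsEquivariant G ξ) [IsFiniteMeasure μ]
    {q : Kernel E F} [IsMarkovKernel q] {S : Set E} (hS : S ∈ ae (μ.map X))
    (hY : HasCondDistrib Y X q μ) (hq : IsEquivariantOn G S q) :
    CondDistribEquivariant G μ X Y := by
  obtain ⟨Q, hQ, hQ_equiv, hqQ⟩ := hq.exists_isEquivariant_ae_eq hξ hS
  exact (condDistribEquivariant_iff_exists_hasCondDistrib hY.aemeasurable_fst
    hY.aemeasurable_snd).2 ⟨Q, hQ, hasCondDistrib_congr hY hqQ, hQ_equiv⟩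

theorem condDistribEquivariant_iff_exists_hasCondDistrib_inv_smul
    [MeasurableSpace.CountablySeparated N] [IsProbabilityMeasure μ] (hξ : IsEquivariant G ξ)
    (hX : AEMeasurable X μ) (hY : AEMeasurable Y μ) {S : Set E} (hS : S ∈ ae (μ.map X))
    {M : E → N} (hM : AEMeasurable M (μ.map X)) (hMS : IsMaximalInvariantOn G S M)
    {γ : E → E} (hγ : AEMeasurable γ (μ.map X)) (hγS : IsOrbitSelectorOn G S γ)
    {κ : Kernel E G} [IsMarkovKernel κ] (hκ : IsEquivariantOn G S κ)
    (hκγ : ∀ x ∈ S, ∀ᵐ t ∂κ x, t • γ x = x)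
    (hT : HasCondDistrib T (fun ω => (X ω, Y ω)) (κ.prodMkRight F) μ) :
    CondDistribEquivariant G μ X Y ↔ ∃ η : Kernel N F, IsMarkovKernel η ∧
      HasCondDistrib (fun ω => (T ω)⁻¹ • Y ω) (fun ω => (X ω, T ω))
        ((η.comap (hM.mk M) hM.measurable_mk).prodMkRight G) μ := by
  constructor
  · rw [condDistribEquivariant_iff_exists_hasCondDistrib hX hY]
    rintro ⟨Q, _, hQ, hQ_equiv⟩
    have : Nonempty E := μ.nonempty_of_neZero.map X
    obtain ⟨η, hη, hQη⟩ := hQ_equiv.exists_ae_eq_map_smul hS hM hMS hγ hγS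
    refine ⟨η, hη, hasCondDistrib_inv_smul hQ hT ?_⟩
    filter_upwards [hQη, hS, hM.ae_eq_mk] with x hx hxS hxM
    rw [Kernel.comap_apply, ← hxM]
    exact (hκγ x hxS).mono hx
  · rintro ⟨η, _, hη⟩
    have hTX : HasCondDistrib T X κ μ := hT.comp_right (f := Prod.fst)
    refine condDistribEquivariant_of_isEquivariantOn hξ (Filter.inter_mem hS hM.ae_eq_mk)
      (hasCondDistrib_smulKernel hTX hη)
      fun g x hx hgx => smulKernel_smul (hκ g x hx.1 hgx.1) ?_
    rw [Kernel.comap_apply, Kernel.comap_apply,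
      (hMS.mk hM _ hgx x hx).2 (MulAction.mem_orbit x g)]

theorem condDistribEquivariant_iff_condIndepGiven_of_isDrawnFrom
    [MeasurableSpace.CountablySeparated N] [IsProbabilityMeasure μ] (hξ : IsEquivariant G ξ)
    (hX : Measurable X) (hY : Measurable Y) {S : Set E} (hS : S ∈ ae (μ.map X))
    {M : E → N} (hM : AEMeasurable M (μ.map X)) (hMS : IsMaximalInvariantOn G S M)
    {γ : E → E} (hγ : AEMeasurable γ (μ.map X)) (hγS : IsOrbitSelectorOn G S γ)
    {ζ : E → Measure G} (hζ : AEMeasurable ζ (μ.map X))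
    (hζ_prob : ∀ x ∈ S, IsProbabilityMeasure (ζ x)) (hζ_equiv : IsEquivariantOn G S ζ)
    (hζγ : ∀ x ∈ S, ∀ᵐ t ∂ζ x, t • γ x = x)
    (hT : Measurable T) (hTζ : IsDrawnFrom μ X Y ζ T) :
    CondDistribEquivariant G μ X Y ↔
      CondIndepGiven μ (fun ω => (T ω, X ω)) (fun ω => (T ω)⁻¹ • Y ω) (fun ω => M (X ω)) := by
  have := Measure.isProbabilityMeasure_map (μ := μ) hX.aemeasurable
  obtain ⟨κ, _, hζκ⟩ := exists_isMarkovKernel_ae_eq hζ (Filter.Eventually.mono hS hζ_prob)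
  have hsub : S ∩ {x | ζ x = κ x} ⊆ S := Set.inter_subset_left
  have hV : Measurable fun ω => (T ω)⁻¹ • Y ω := hT.inv.smul hY
  rw [condDistribEquivariant_iff_exists_hasCondDistrib_inv_smul hξ hX.aemeasurable hY.aemeasurable
      (Filter.inter_mem hS hζκ) hM (hMS.mono hsub) hγ (hγS.mono hsub)
      ((hζ_equiv.mono hsub).congr fun x hx => hx.2) (fun x hx => hx.2 ▸ hζγ x hx.1)
      (hTζ.hasCondDistrib hX hY hT hζκ),
    condIndepGiven_iff_exists_hasCondDistrib_comap (hT.prodMk hX).aemeasurable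
      hV.aemeasurable (hM.measurable_mk.comp measurable_snd)
      (ae_of_ae_map hX.aemeasurable hM.ae_eq_mk)]
  exact exists_congr fun η => and_congr_right fun _ =>
    (hasCondDistrib_comp_iff_of_leftInverse (U := fun ω => (X ω, T ω))
      (κ := η.comap (hM.mk M ∘ Prod.snd) (hM.measurable_mk.comp measurable_snd))
      measurable_swap measurable_swap Prod.swap_swap (hX.prodMk hT).aemeasurable).symm

theorem condDistribEquivariant_iff_condIndepGiven_of_isRepresentativeInversionOn
    [MeasurableSpace.CountablySeparated N] [IsProbabilityMeasure μ] (hξ : IsEquivariant G ξ)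
    (hX : Measurable X) (hY : Measurable Y) {S : Set E} (hS : S ∈ ae (μ.map X))
    {M : E → N} (hM : AEMeasurable M (μ.map X)) (hMS : IsMaximalInvariantOn G S M)
    {γ : E → E} (hγ : AEMeasurable γ (μ.map X)) (hγS : IsOrbitSelectorOn G S γ)
    {τ : E → G} (hτ : AEMeasurable τ (μ.map X)) (hτS : IsRepresentativeInversionOn S γ τ) :
    CondDistribEquivariant G μ X Y ↔
      CondIndepGiven μ X (fun ω => (τ (X ω))⁻¹ • Y ω) (fun ω => M (X ω)) := by
  have hT : Measurable (hτ.mk τ ∘ X) := hτ.measurable_mk.comp hX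
  have hτT : τ ∘ X =ᵐ[μ] hτ.mk τ ∘ X := ae_of_ae_map hX.aemeasurable hτ.ae_eq_mk
  have hV : Measurable fun ω => ((hτ.mk τ ∘ X) ω)⁻¹ • Y ω := hT.inv.smul hY
  have hτV : (fun ω => (τ (X ω))⁻¹ • Y ω) =ᵐ[μ] fun ω => ((hτ.mk τ ∘ X) ω)⁻¹ • Y ω :=
    hτT.inv.smul .rfl
  have hMX : AEMeasurable (fun ω => M (X ω)) μ := hM.comp_measurable hX
  rw [condIndepGiven_congr .rfl hτV .rfl,
    ← condIndepGiven_comp_left_iff_of_leftInverse hX.aemeasurable hV.aemeasurable hMX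
      (hτ.measurable_mk.prodMk measurable_id) measurable_snd fun _ => rfl]
  refine condDistribEquivariant_iff_condIndepGiven_of_isDrawnFrom hξ hX hY hS hM hMS hγ hγS
    (Measure.measurable_dirac.comp_aemeasurable hτ) (fun _ _ => Measure.dirac.isProbabilityMeasure)
    (fun g x hx _ => ?_) (fun x hx => ?_) hT (isDrawnFrom_dirac hT hτT)
  · rw [Function.comp_apply, (hτS x hx).2 g, Function.comp_apply,
      Measure.map_dirac' (measurable_const_smul g), smul_eq_mul]
  · refine (ae_dirac_iff ?_).2 (hτS x hx).1
    exact measurable_smul_const (γ x) (measurableSet_singleton x)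

theorem condDistribEquivariant_iff_condIndepGiven_of_forall_smul_eq
    [MeasurableSpace.CountablySeparated N] [IsProbabilityMeasure μ] (hξ : IsEquivariant G ξ)
    (hX : AEMeasurable X μ) (hY : AEMeasurable Y μ) {S : Set E} (hS : S ∈ ae (μ.map X))
    {M : E → N} (hM : AEMeasurable M (μ.map X)) (hMS : IsMaximalInvariantOn G S M)
    (htriv : ∀ (g : G) (y : F), g • y = y) :
    CondDistribEquivariant G μ X Y ↔ CondIndepGiven μ X Y (fun ω => M (X ω)) := by
  have map_smul (g : G) (ν : Measure F) : ν.map (g • ·) = ν := by simp only [htriv, Measure.map_id']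
  rw [condIndepGiven_iff_exists_hasCondDistrib_comap hX hY hM.measurable_mk
    (ae_of_ae_map hX hM.ae_eq_mk)]
  constructor
  · rw [condDistribEquivariant_iff_exists_hasCondDistrib hX hY]
    rintro ⟨Q, _, hQ, hQ_equiv⟩
    have : Nonempty E := μ.nonempty_of_neZero.map X
    obtain ⟨γ, hγ, hsel⟩ := exists_aemeasurable_isOrbitSelectorOn_univ hξ (P := μ.map X)
    obtain ⟨η, hη, hQη⟩ :=
      hQ_equiv.exists_ae_eq_map_smul hS hM hMS hγ (hsel.mono (Set.subset_univ S))
    refine ⟨η, hη, hasCondDistrib_congr hQ ?_⟩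
    filter_upwards [hQη, hM.ae_eq_mk] with x hx hxM
    obtain ⟨t, ht⟩ := MulAction.mem_orbit_symm.1 (hsel.1 x trivial)
    rw [hx t ht, map_smul, Kernel.comap_apply, hxM]
  · rintro ⟨η, _, hη⟩
    refine condDistribEquivariant_of_isEquivariantOn hξ (Filter.inter_mem hS hM.ae_eq_mk) hη
      fun g x hx hgx => ?_
    rw [map_smul, Kernel.comap_apply, Kernel.comap_apply,
      (hMS.mk hM _ hgx x hx).2 (MulAction.mem_orbit x g)]

end Characterization

theorem IsInversionKernelOn.isEquivariantOn {G E : Type*} [Group G] [TopologicalSpace G]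
    [MeasurableSpace G] [MeasurableMul G] [MulAction G E] {S : Set E} {γ : E → E}
    {ζ : E → Measure G} (h : IsInversionKernelOn S γ ζ) : IsEquivariantOn G S ζ := by
  intro g x hx _
  ext B hB
  rw [h.equivariant x hx g B hB, Measure.map_apply (measurable_const_smul g) hB, Set.preimage_smul]

theorem mainTheorem3_general {G E F N Ω : Type*}
    [Group G] [TopologicalSpace G] [IsTopologicalGroup G] [LocallyCompactSpace G]
    [SecondCountableTopology G] [T2Space G] [MeasurableSpace G] [BorelSpace G]
    [MeasurableSpace E] [StandardBorelSpace E] [MeasurableSpace F]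
    [MeasurableSpace N] [MeasurableSpace.CountablySeparated N]
    [MulAction G E] [MeasurableSMul₂ G E] [MulAction G F] [MeasurableSMul₂ G F]
    (hproper : IsProperAction G E)
    [MeasurableSpace Ω] (μ : Measure Ω) [IsProbabilityMeasure μ]
    (X : Ω → E) (hX : Measurable X) (Y : Ω → F) (hY : Measurable Y) :
    (∃ (γ : E → E) (ζ : E → Measure G),
      AEMeasurable γ (μ.map X) ∧ AEMeasurable ζ (μ.map X) ∧
      IsOrbitSelectorOn G Set.univ γ ∧ IsInversionKernelOn Set.univ γ ζ) ∧
    ∀ (S : Set E), μ.map X Sᶜ = 0 →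
    ∀ (M : E → N), AEMeasurable M (μ.map X) → IsMaximalInvariantOn G S M →
      (∀ (γ : E → E) (ζ : E → Measure G),
        AEMeasurable γ (μ.map X) → IsOrbitSelectorOn G S γ →
        AEMeasurable ζ (μ.map X) → IsInversionKernelOn S γ ζ →
        ∀ T : Ω → G, Measurable T → IsDrawnFrom μ X Y ζ T →
          (CondDistribEquivariant G μ X Y ↔
            CondIndepGiven μ (fun ω => (T ω, X ω)) (fun ω => (T ω)⁻¹ • Y ω)
              (fun ω => M (X ω)))) ∧
      (∀ (γ : E → E) (τ : E → G),
        AEMeasurable γ (μ.map X) → IsOrbitSelectorOn G S γ →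
        AEMeasurable τ (μ.map X) → IsRepresentativeInversionOn S γ τ →
          (CondDistribEquivariant G μ X Y ↔
            CondIndepGiven μ X (fun ω => (τ (X ω))⁻¹ • Y ω) (fun ω => M (X ω)))) ∧
      ((∀ (g : G) (y : F), g • y = y) →
        (CondDistribEquivariant G μ X Y ↔ CondIndepGiven μ X Y (fun ω => M (X ω)))) := by
  have := polishSpace_of_locallyCompact_group G
  have := Measure.isProbabilityMeasure_map (μ := μ) hX.aemeasurable
  obtain ⟨ξ, _, hξ⟩ := hproper.exists_isEquivariant_kernel
  obtain ⟨γ, hγ, hsel⟩ := exists_aemeasurable_isOrbitSelectorOn_univ hξ (P := μ.map X)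
  obtain ⟨ζ, hζ, hinv⟩ := exists_isInversionKernelOn_univ hξ hγ hsel
  refine ⟨⟨γ, ζ, hγ, hζ, hsel, hinv⟩, fun S hS M hM hMS => ⟨?_, ?_, ?_⟩⟩
  · exact fun γ ζ hγ hγS hζ hζS T hT hTζ =>
      condDistribEquivariant_iff_condIndepGiven_of_isDrawnFrom hξ hX hY hS hM hMS hγ hγS hζ
        hζS.isProb hζS.isEquivariantOn hζS.inverts hT hTζ
  · exact fun γ τ hγ hγS hτ hτS =>
      condDistribEquivariant_iff_condIndepGiven_of_isRepresentativeInversionOn hξ hX hY hS hM hMS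
        hγ hγS hτ hτS
  · exact condDistribEquivariant_iff_condIndepGiven_of_forall_smul_eq hξ hX.aemeasurable
      hY.aemeasurable hS hM hMS

theorem mainTheorem3 {G E F N Ω : Type*}
    -- a locally compact, second countable, Hausdorff group with its Borel sets
    [Group G] [TopologicalSpace G] [IsTopologicalGroup G] [LocallyCompactSpace G]
    [SecondCountableTopology G] [T2Space G] [MeasurableSpace G] [BorelSpace G]
    -- the spaces of `X`, of `Y` and of the maximal invariant
    [TopologicalSpace E] [MeasurableSpace E] [BorelSpace E] [StandardBorelSpace E]
    [TopologicalSpace F] [MeasurableSpace F] [BorelSpace F] [StandardBorelSpace F]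
    [MeasurableSpace N] [StandardBorelSpace N]
    -- continuous actions, the one on `E` proper
    [MulAction G E] [ContinuousSMul G E] [MulAction G F] [ContinuousSMul G F]
    (hproper : IsProperAction G E)
    [MeasurableSpace Ω] (μ : Measure Ω) [IsProbabilityMeasure μ]
    (X : Ω → E) (hX : Measurable X) (Y : Ω → F) (hY : Measurable Y) :
    -- a measurable inversion kernel exists
    (∃ (γ : E → E) (ζ : E → Measure G),
      AEMeasurable γ (μ.map X) ∧ AEMeasurable ζ (μ.map X) ∧
      IsOrbitSelectorOn G Set.univ γ ∧ IsInversionKernelOn Set.univ γ ζ) ∧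
    -- `S` is a set of full measure on which the defining properties hold
    ∀ (S : Set E), μ.map X Sᶜ = 0 →
    ∀ (M : E → N), AEMeasurable M (μ.map X) → IsMaximalInvariantOn G S M →
      -- the characterization by means of an inversion kernel
      (∀ (γ : E → E) (ζ : E → Measure G),
        AEMeasurable γ (μ.map X) → IsOrbitSelectorOn G S γ →
        AEMeasurable ζ (μ.map X) → IsInversionKernelOn S γ ζ →
        ∀ T : Ω → G, Measurable T → IsDrawnFrom μ X Y ζ T →
          (CondDistribEquivariant G μ X Y ↔
            CondIndepGiven μ (fun ω => (T ω, X ω)) (fun ω => (T ω)⁻¹ • Y ω)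
              (fun ω => M (X ω)))) ∧
      -- the case of a measurable representative inversion
      (∀ (γ : E → E) (τ : E → G),
        AEMeasurable γ (μ.map X) → IsOrbitSelectorOn G S γ →
        AEMeasurable τ (μ.map X) → IsRepresentativeInversionOn S γ τ →
          (CondDistribEquivariant G μ X Y ↔
            CondIndepGiven μ X (fun ω => (τ (X ω))⁻¹ • Y ω) (fun ω => M (X ω)))) ∧
      -- the case of a trivial action on `F`
      ((∀ (g : G) (y : F), g • y = y) →
        (CondDistribEquivariant G μ X Y ↔ CondIndepGiven μ X Y (fun ω => M (X ω))))
  :=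
  mainTheorem3_general hproper μ X hX Y hY
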